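/- For $x\in[0,1]$ let $H_2(x)=-x\ln x-(1-x)\ln(1-x)$ (with $0\ln 0=0$) and $\mathcal O_x=\{U\,\mathrm{diag}(1-x,x)\,U^\dagger: U\in \mathrm U(2)\}$. For qubit density matrices let $S(\rho)=-\mathrm{Tr}(\rho\ln\rho)$, $S(\rho\|\sigma)=\mathrm{Tr}(\rho(\ln\rho-\ln\sigma))$, $$\mathrm{QJSD}(\rho_1,\rho_2)=\tfrac12\big[S(\rho_1\|\bar\rho)+S(\rho_2\|\bar\rho)\big],\quad \bar\rho=\tfrac12\rho_1+\tfrac12\rho_2,\qquad \mathcal C(\rho)=S(\rho_{\mathrm{diag}})-S(\rho),$$ where $\rho_{\mathrm{diag}}$ is the diagonal part of $\rho$. Put $$F_0(x)=\tfrac14(1-x)^2[2\ln(1-x)-1]-\tfrac14x^2[2\ln x-1],$$ $$F_1(x)=\tfrac14(1-x)^2[2\ln(1-x)-1]-\tfrac19(1-x)^3[3\ln(1-x)-1]-\tfrac19x^3[3\ln x-1]$$ for $x\in[0,1]$ (terms $y^k\ln y$, $k\ge1$, being $0$ at $y=0$), $T_0=\frac{\mu+\nu}2$, $T_1=\frac{1-|\mu-\nu|}2$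 and $\Phi(\mu,\nu)=F_1(T_0)+F_1(1-T_0)-F_1(T_1)-F_1(1-T_1)$. Then $F_0'(x)=H_2(x)$ and $F_1'(x)=xH_2(x)$ for $x\in(0,1)$. Let $\mu,\nu\in[0,\frac12]$, $\rho_1\in\mathcal O_\mu$, $\rho_2\in\mathcal O_\nu$. With respect to the product of the normalized Haar measures on $\mathrm U(2)\times\mathrm U(2)$, the integrands in $$\overline{\mathrm{QJSD}}(\mathcal O_\mu,\mathcal O_\nu)=\iint \mathrm{QJSD}(U\rho_1U^\dagger,V\rho_2V^\dagger)\,dU\,dV,\qquad \overline{\mathcal C}(\mathcal O_\mu,\mathcal O_\nu)=\iint \mathcal C\big(\tfrac12U\rho_1U^\dagger+\tfrac12V\rho_2V^\dagger\big)\,dU\,dV$$ are integrable. If $\mu,\nu<\frac12$, then $$\overline{\mathrm{QJSD}}(\mathcal O_\mu,\mathcal O_\nu)=\varphi(\mu,\nu):=\frac{F_1(T_0)+F_1(1-T_0)-F_1(T_1)-F_1(1-T_1)}{(\frac12-\mu)(\frac12-\nu)}-\tfrac12H_2(\mu)-\tfrac12H_2(\nu),$$ $$\overline{\mathcal C}(\mathcal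 O_\mu,\mathcal O_\nu)=\psi(\mu,\nu):=\frac{(2T_0-1)F_0(T_0)-(2T_1-1)F_0(T_1)-2\Phi(\mu,\nu)}{(\frac12-\mu)(\frac12-\nu)}.$$ For every $(\mu,\nu)\in[0,\frac12]^2$, including $\mu=\frac12$ or $\nu=\frac12$, the two averages are the limits of $\varphi(\mu',\nu')$ and $\psi(\mu',\nu')$ as $(\mu',\nu')\to(\mu,\nu)$ within $[0,\frac12)^2$. -/

import Mathlib

open MeasureTheory Filter Topology
open scoped Matrix

namespace QubitOrbits

noncomputable section

/-- Complex `2 × 2` matrices. -/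
abbrev Mat2 : Type := Matrix (Fin 2) (Fin 2) ℂ

/-- The unitary group `U(2)`. -/
abbrev U2 : Type := Matrix.unitaryGroup (Fin 2) ℂ

instance instMeasurableSpaceU2 : MeasurableSpace U2 := borel U2

instance instBorelSpaceU2 : BorelSpace U2 := ⟨rfl⟩

instance instSecondCountableU2 : SecondCountableTopology U2 := by
  have : SecondCountableTopology Mat2 :=
    inferInstanceAs (SecondCountableTopology (Fin 2 → Fin 2 → ℂ))
  exact TopologicalSpace.Subtype.secondCountableTopology {A : Mat2 | A ∈ Matrix.unitaryGroup (Fin 2) ℂ}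

instance instCompactSpaceU2 : CompactSpace U2 := by
  have hclosed : IsClosed {A : Mat2 | A * star A = 1} :=
    isClosed_eq (by fun_prop) continuous_const
  have hbox : IsCompact
      (Set.pi Set.univ fun _ : Fin 2 => Set.pi Set.univ fun _ : Fin 2 =>
        Metric.closedBall (0 : ℂ) 1) :=
    isCompact_univ_pi fun _ => isCompact_univ_pi fun _ => isCompact_closedBall 0 1
  have hset : {A : Mat2 | A ∈ Matrix.unitaryGroup (Fin 2) ℂ} = {A : Mat2 | A * star A = 1} := by
    ext A
    exact Matrix.mem_unitaryGroup_iff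
  have hcompact : IsCompact {A : Mat2 | A ∈ Matrix.unitaryGroup (Fin 2) ℂ} := by
    rw [hset]
    refine IsCompact.of_isClosed_subset hbox hclosed ?_
    intro A hA i _ j _
    rw [mem_closedBall_zero_iff]
    exact entry_norm_bound_of_unitary (Matrix.mem_unitaryGroup_iff.mpr hA) i j
  exact isCompact_iff_compactSpace.mp hcompact

/-- The normalised Haar measure on `U(2)`. -/
def haarU2 : Measure U2 := Measure.haarMeasure ⊤

instance instIsHaarMeasureHaarU2 : haarU2.IsHaarMeasure :=
  inferInstanceAs (Measure.haarMeasure ⊤).IsHaarMeasure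

instance instIsProbabilityMeasureHaarU2 : IsProbabilityMeasure haarU2 where
  measure_univ := by
    have h := Measure.haarMeasure_self (K₀ := (⊤ : TopologicalSpace.PositiveCompacts U2))
    simpa [haarU2] using h

/-- The conjugate `U ρ U†`. -/
def conj (U : U2) (ρ : Mat2) : Mat2 := (U : Mat2) * ρ * (U : Mat2)ᴴ

/-- The matrix `diag(1 - x, x)`. -/
def diagState (x : ℝ) : Mat2 := Matrix.diagonal ![((1 - x : ℝ) : ℂ), ((x : ℝ) : ℂ)]

/-- The unitary orbit `O_x = {U diag(1 - x, x) U† : U ∈ U(2)}`: the qubit states with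
spectrum `(1 - x, x)`. -/
def orbit (x : ℝ) : Set Mat2 := {ρ | ∃ U : U2, ρ = conj U (diagState x)}

/-- The matrix logarithm of a positive semidefinite matrix, through the spectral functional
calculus, with `ln 0 = 0` on the kernel (this implements the convention `0 ln 0 = 0` below). -/
def matLog (ρ : Mat2) : Mat2 := cfc Real.log ρ

/-- The von Neumann entropy `S(ρ) = -Tr(ρ ln ρ)`. -/
def vnEntropy (ρ : Mat2) : ℝ := -(Matrix.trace (ρ * matLog ρ)).re

/-- The relative entropy `S(ρ‖σ) = Tr(ρ (ln ρ - ln σ))`, for states with `ker σ ⊆ ker ρ`.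
It is only used for `σ = (ρ + τ) / 2` with `τ` a state, where that inclusion always holds. -/
def relEntropy (ρ σ : Mat2) : ℝ := (Matrix.trace (ρ * (matLog ρ - matLog σ))).re

/-- The uniform mixture `(ρ₁ + ρ₂) / 2`. -/
def mixture (ρ₁ ρ₂ : Mat2) : Mat2 := (1 / 2 : ℂ) • ρ₁ + (1 / 2 : ℂ) • ρ₂

/-- The quantum Jensen–Shannon divergence. -/
def QJSD (ρ₁ ρ₂ : Mat2) : ℝ :=
  1 / 2 * (relEntropy ρ₁ (mixture ρ₁ ρ₂) + relEntropy ρ₂ (mixture ρ₁ ρ₂))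

/-- The diagonal part of a matrix. -/
def diagPart (ρ : Mat2) : Mat2 := Matrix.diagonal fun i => ρ i i

/-- The relative entropy of coherence `C(ρ) = S(ρ_diag) - S(ρ)`. -/
def coherence (ρ : Mat2) : ℝ := vnEntropy (diagPart ρ) - vnEntropy ρ

/-- The average of `QJSD(U ρ₁ U†, V ρ₂ V†)` over independent Haar unitaries `U`, `V`. -/
def avgQJSD (ρ₁ ρ₂ : Mat2) : ℝ :=
  ∫ U, ∫ V, QJSD (conj U ρ₁) (conj V ρ₂) ∂haarU2 ∂haarU2

/-- The average of `C((U ρ₁ U† + V ρ₂ V†) / 2)` over independent Haar unitaries `U`, `V`. -/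
def avgCoherence (ρ₁ ρ₂ : Mat2) : ℝ :=
  ∫ U, ∫ V, coherence (mixture (conj U ρ₁) (conj V ρ₂)) ∂haarU2 ∂haarU2

/-- The binary entropy `H₂(x) = -x ln x - (1 - x) ln (1 - x)`. -/
def H2 (x : ℝ) : ℝ := -x * Real.log x - (1 - x) * Real.log (1 - x)

/-- The antiderivative of `H₂(x)` (powers times logarithms vanish at `0`). -/
def F0 (x : ℝ) : ℝ :=
  1 / 4 * (1 - x) ^ 2 * (2 * Real.log (1 - x) - 1) - 1 / 4 * x ^ 2 * (2 * Real.log x - 1)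

/-- The antiderivative of `x H₂(x)`. -/
def F1 (x : ℝ) : ℝ :=
  1 / 4 * (1 - x) ^ 2 * (2 * Real.log (1 - x) - 1)
    - 1 / 9 * (1 - x) ^ 3 * (3 * Real.log (1 - x) - 1)
    - 1 / 9 * x ^ 3 * (3 * Real.log x - 1)

/-- `T₀ = (μ + ν) / 2`. -/
def T0 (μ ν : ℝ) : ℝ := (μ + ν) / 2

/-- `T₁ = (1 - |μ - ν|) / 2`. -/
def T1 (μ ν : ℝ) : ℝ := (1 - |μ - ν|) / 2

/-- `Φ(μ, ν) = F₁(T₀) + F₁(1 - T₀) - F₁(T₁) - F₁(1 - T₁)`. -/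
def Phi (μ ν : ℝ) : ℝ :=
  F1 (T0 μ ν) + F1 (1 - T0 μ ν) - F1 (T1 μ ν) - F1 (1 - T1 μ ν)

/-- The closed form for the average quantum Jensen–Shannon divergence, `μ, ν ≠ 1 / 2`. -/
def phiFormula (μ ν : ℝ) : ℝ :=
  Phi μ ν / ((1 / 2 - μ) * (1 / 2 - ν)) - 1 / 2 * H2 μ - 1 / 2 * H2 ν

/-- The closed form for the average coherence, `μ, ν ≠ 1 / 2`. -/
def psiFormula (μ ν : ℝ) : ℝ :=
  ((2 * T0 μ ν - 1) * F0 (T0 μ ν) - (2 * T1 μ ν - 1) * F0 (T1 μ ν) - 2 * Phi μ ν)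
    / ((1 / 2 - μ) * (1 / 2 - ν))

end

end QubitOrbits

namespace QubitOrbits

/-! ### Entropy of qubit states -/

/-! A trace-one Hermitian `2 × 2` matrix has its entropy fixed by its determinant, so both
integrands become functions of transition probabilities. `QJSD` is the entropy of the mixture minus
the mean entropy of the two states. By unitary invariance the mixture's entropy depends only on `p =
|W₀₀|²` for the relative unitary `W`: its eigenvalues are `(1 ± r)/2`, with `r²` affine in `p`. The
entropy of its diagonal part depends, affinely inside `H2`, on two independent such probabilities.

The key probabilistic fact is that `|U₀₀|²` is uniform on `[0, 1]` for Haar `U`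
(`integral_comp_prob`), proved from its moments. The averages thus become elementary integrals over
`[0, 1]` or `[0, 1]²`, evaluated by `F0` and `F1` (`avgMixEntropy_eq`, `avgDiagEntropy_eq`). These
integrals are continuous in `(μ, ν)` everywhere, which gives the limits at `1 / 2`, where the closed
forms have a vanishing denominator. -/

lemma H2_eq_binEntropy : H2 = Real.binEntropy := by
  funext x
  simp only [H2, Real.binEntropy, Real.log_inv]
  ring

@[fun_prop]
lemma continuous_H2 : Continuous H2 := by
  rw [H2_eq_binEntropy]
  exact Real.binEntropy_continuous

lemma H2_one_sub (x : ℝ) : H2 (1 - x) = H2 x := by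
  rw [H2_eq_binEntropy, Real.binEntropy_one_sub]

lemma vnEntropy_eq_neg_sum_eigenvalues {ρ : Mat2} (h : ρ.IsHermitian) :
    vnEntropy ρ = -∑ i, h.eigenvalues i * Real.log (h.eigenvalues i) := by
  have key : ρ * matLog ρ = (Unitary.conjStarAlgAut ℂ Mat2 h.eigenvectorUnitary)
      (Matrix.diagonal fun i => ((h.eigenvalues i * Real.log (h.eigenvalues i) : ℝ) : ℂ)) := by
    rw [matLog, h.cfc_eq, Matrix.IsHermitian.cfc]
    nth_rewrite 1 [h.spectral_theorem]
    rw [← map_mul, Matrix.diagonal_mul_diagonal]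
    congr 2
    funext i
    simp
  rw [vnEntropy, key, Unitary.conjStarAlgAut_apply, Matrix.trace_mul_cycle]
  simp [Matrix.trace_diagonal]

lemma vnEntropy_eq_H2 {ρ : Mat2} (h : ρ.IsHermitian) (ht : ρ.trace = 1) {x : ℝ}
    (hd : ρ.det = ((x * (1 - x) : ℝ) : ℂ)) : vnEntropy ρ = H2 x := by
  rw [vnEntropy_eq_neg_sum_eigenvalues h, Fin.sum_univ_two]
  rw [h.trace_eq_sum_eigenvalues, Fin.sum_univ_two] at ht
  rw [h.det_eq_prod_eigenvalues, Fin.prod_univ_two] at hd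
  have ht' : h.eigenvalues 0 + h.eigenvalues 1 = 1 :=
    Complex.ofReal_injective (by push_cast; exact ht)
  have hd' : h.eigenvalues 0 * h.eigenvalues 1 = x * (1 - x) :=
    Complex.ofReal_injective (by rw [Complex.ofReal_mul]; exact hd)
  have h1 : h.eigenvalues 1 = 1 - h.eigenvalues 0 := by linarith
  rw [h1] at hd' ⊢
  -- Sum `1` and product `x(1 - x)` force the eigenvalues to be `x` and `1 - x`, in one order or the
  -- other.
  have hroot : (h.eigenvalues 0 - x) * (h.eigenvalues 0 - (1 - x)) = 0 := by linarith
  rcases mul_eq_zero.mp hroot with h0 | h0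
  · rw [sub_eq_zero.mp h0, H2]; ring
  · rw [sub_eq_zero.mp h0, H2, sub_sub_cancel]; ring

/-! ### Conjugation and mixtures -/

lemma U2_mul_conjTranspose (U : U2) : (U : Mat2) * (U : Mat2)ᴴ = 1 :=
  Matrix.mem_unitaryGroup_iff.mp U.2

lemma U2_conjTranspose_mul (U : U2) : (U : Mat2)ᴴ * (U : Mat2) = 1 :=
  Matrix.mem_unitaryGroup_iff'.mp U.2

lemma conj_conj (U V : U2) (ρ : Mat2) : conj U (conj V ρ) = conj (U * V) ρ := by
  simp [conj, Matrix.mul_assoc]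

lemma conj_mixture (U : U2) (ρ σ : Mat2) :
    conj U (mixture ρ σ) = mixture (conj U ρ) (conj U σ) := by
  simp [conj, mixture, Matrix.mul_add, Matrix.add_mul]

lemma det_conj (U : U2) (ρ : Mat2) : (conj U ρ).det = ρ.det := by
  rw [conj, Matrix.det_mul_right_comm, U2_mul_conjTranspose, one_mul]

lemma trace_conj (U : U2) (ρ : Mat2) : (conj U ρ).trace = ρ.trace := by
  rw [conj, Matrix.trace_mul_cycle, U2_conjTranspose_mul, one_mul]

lemma isHermitian_conj (U : U2) {ρ : Mat2} (h : ρ.IsHermitian) : (conj U ρ).IsHermitian :=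
  Matrix.isHermitian_mul_mul_conjTranspose _ h

lemma isHermitian_diagState (x : ℝ) : (diagState x).IsHermitian := by
  ext i j
  fin_cases i <;> fin_cases j <;> simp [diagState]

lemma trace_diagState (x : ℝ) : (diagState x).trace = 1 := by
  simp [diagState]

lemma det_diagState (x : ℝ) : (diagState x).det = ((x * (1 - x) : ℝ) : ℂ) := by
  simp [diagState, mul_comm]

lemma isHermitian_mixture {ρ σ : Mat2} (hρ : ρ.IsHermitian) (hσ : σ.IsHermitian) :
    (mixture ρ σ).IsHermitian := by
  have h : ∀ {A : Mat2}, A.IsHermitian → ((1 / 2 : ℂ) • A).IsHermitian := by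
    intro A hA
    rw [Matrix.IsHermitian, Matrix.conjTranspose_smul, hA.eq]
    simp
  exact (h hρ).add (h hσ)

lemma trace_mixture {ρ σ : Mat2} (hρ : ρ.trace = 1) (hσ : σ.trace = 1) :
    (mixture ρ σ).trace = 1 := by
  rw [mixture, Matrix.trace_add, Matrix.trace_smul, Matrix.trace_smul, hρ, hσ]
  norm_num

/-- The trace is linear, so the two cross terms of the relative entropies average to the trace
defining the entropy of the mixture. -/
lemma QJSD_eq_vnEntropy (ρ σ : Mat2) :
    QJSD ρ σ = vnEntropy (mixture ρ σ) - 1 / 2 * vnEntropy ρ - 1 / 2 * vnEntropy σ := by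
  have h : (mixture ρ σ * matLog (mixture ρ σ)).trace
      = (1 / 2 : ℂ) * (ρ * matLog (mixture ρ σ)).trace
        + (1 / 2 : ℂ) * (σ * matLog (mixture ρ σ)).trace := by
    -- Only the left factor is unfolded; the mixture inside the logarithm stays intact.
    conv_lhs => enter [1, 1]; rw [mixture]
    simp [Matrix.add_mul]
  have h' := congrArg Complex.re h
  have e : (1 / 2 : ℂ) = ((1 / 2 : ℝ) : ℂ) := by norm_num
  rw [e, Complex.add_re, Complex.re_ofReal_mul, Complex.re_ofReal_mul] at h'
  simp only [QJSD, relEntropy, vnEntropy, Matrix.mul_sub, Matrix.trace_sub, Complex.sub_re]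
  linarith

/-! ### Transition probabilities -/

/-- The transition probability `|U₀₀|²`. -/
noncomputable def prob (U : U2) : ℝ := Complex.normSq ((U : Mat2) 0 0)

@[fun_prop]
lemma continuous_prob : Continuous prob := by
  unfold prob
  exact Complex.continuous_normSq.comp
    ((continuous_apply_apply (0 : Fin 2) (0 : Fin 2)).comp continuous_subtype_val)

lemma prob_add_normSq_row (U : U2) : prob U + Complex.normSq ((U : Mat2) 0 1) = 1 := by
  have h := congrFun (congrFun (U2_mul_conjTranspose U) 0) 0
  simp only [Matrix.mul_apply, Fin.sum_univ_two, Matrix.conjTranspose_apply, Matrix.one_apply_eq,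
    Complex.star_def, Complex.mul_conj] at h
  exact_mod_cast h

lemma prob_add_normSq_col (U : U2) : prob U + Complex.normSq ((U : Mat2) 1 0) = 1 := by
  have h := congrFun (congrFun (U2_conjTranspose_mul U) 0) 0
  simp only [Matrix.mul_apply, Fin.sum_univ_two, Matrix.conjTranspose_apply, Matrix.one_apply_eq,
    Complex.star_def, ← Complex.normSq_eq_conj_mul_self] at h
  exact_mod_cast h

lemma prob_mem_Icc (U : U2) : prob U ∈ Set.Icc (0 : ℝ) 1 := by
  have h := prob_add_normSq_row U
  have h0 : 0 ≤ prob U := Complex.normSq_nonneg _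
  have h1 := Complex.normSq_nonneg ((U : Mat2) 0 1)
  exact ⟨h0, by linarith⟩

lemma conj_diagState_zero_zero (U : U2) (x : ℝ) :
    conj U (diagState x) 0 0 = ((x + (1 - 2 * x) * prob U : ℝ) : ℂ) := by
  have h : conj U (diagState x) 0 0
      = (((1 - x) * prob U + x * Complex.normSq ((U : Mat2) 0 1) : ℝ) : ℂ) := by
    simp only [conj, diagState, Matrix.mul_apply, Fin.sum_univ_two, Matrix.conjTranspose_apply,
      Matrix.diagonal_apply, prob]
    push_cast
    simp only [← Complex.mul_conj]
    simp
    ring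
  rw [h]
  congr 1
  linear_combination x * prob_add_normSq_row U

/-- Half the distance between the eigenvalues of the mixture of two states with spectra
`(1 - μ, μ)` and `(1 - ν, ν)` and transition probability `p`. -/
noncomputable def mixRadius (μ ν p : ℝ) : ℝ := √((μ - ν) ^ 2 + (1 - 2 * μ) * (1 - 2 * ν) * p)

/-- Since `diagState μ` is diagonal, the off-diagonal entries of the mixture are half those of the
conjugate. Their product follows from its known determinant and diagonal, so the phases of `U` never
enter. -/
lemma det_mixture_diagState_conj (U : U2) (μ ν : ℝ) :
    (mixture (diagState μ) (conj U (diagState ν))).det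
      = (((1 - ((μ - ν) ^ 2 + (1 - 2 * μ) * (1 - 2 * ν) * prob U)) / 4 : ℝ) : ℂ) := by
  have h00 := conj_diagState_zero_zero U ν
  have ht := (trace_conj U (diagState ν)).trans (trace_diagState ν)
  have hd := (det_conj U (diagState ν)).trans (det_diagState ν)
  rw [Matrix.trace_fin_two] at ht
  rw [Matrix.det_fin_two] at hd ⊢
  have h11 : conj U (diagState ν) 1 1 = 1 - conj U (diagState ν) 0 0 := by linear_combination ht
  simp only [mixture, diagState, Matrix.add_apply, Matrix.smul_apply, smul_eq_mul,
    Matrix.diagonal_apply] at h00 h11 hd ⊢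
  simp only [h11, h00] at hd ⊢
  push_cast at hd ⊢
  simp
  linear_combination (1 / 4 : ℂ) * hd

/-- Factoring out a common conjugation leaves only the relative unitary, reducing to the case where
the first state is diagonal. -/
lemma mixture_conj_conj (A B : U2) (ρ σ : Mat2) :
    mixture (conj A ρ) (conj B σ) = conj A (mixture ρ (conj (A⁻¹ * B) σ)) := by
  rw [conj_mixture, conj_conj, mul_inv_cancel_left]

lemma mixRadius_sq {μ ν p : ℝ} (hμ : μ ≤ 1 / 2) (hν : ν ≤ 1 / 2) (hp : 0 ≤ p) :
    mixRadius μ ν p ^ 2 = (μ - ν) ^ 2 + (1 - 2 * μ) * (1 - 2 * ν) * p := by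
  have h1 : 0 ≤ 1 - 2 * μ := by linarith
  have h2 : 0 ≤ 1 - 2 * ν := by linarith
  exact Real.sq_sqrt (by positivity)

/-- The entropy of the mixture as a function of the transition probability. -/
noncomputable def mixEntropy (μ ν p : ℝ) : ℝ := H2 ((1 - mixRadius μ ν p) / 2)

lemma vnEntropy_mixture {μ ν : ℝ} (hμ : μ ≤ 1 / 2) (hν : ν ≤ 1 / 2) (A B : U2) :
    vnEntropy (mixture (conj A (diagState μ)) (conj B (diagState ν)))
      = mixEntropy μ ν (prob (A⁻¹ * B)) := by
  refine vnEntropy_eq_H2 (isHermitian_mixture (isHermitian_conj _ (isHermitian_diagState _))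
    (isHermitian_conj _ (isHermitian_diagState _)))
    (trace_mixture (by rw [trace_conj, trace_diagState]) (by rw [trace_conj, trace_diagState])) ?_
  rw [mixture_conj_conj, det_conj, det_mixture_diagState_conj]
  congr 1
  rw [← mixRadius_sq hμ hν (prob_mem_Icc _).1]
  ring

lemma vnEntropy_conj_diagState (A : U2) (x : ℝ) : vnEntropy (conj A (diagState x)) = H2 x :=
  vnEntropy_eq_H2 (isHermitian_conj _ (isHermitian_diagState _))
    (by rw [trace_conj, trace_diagState]) (by rw [det_conj, det_diagState])

lemma vnEntropy_diagPart {ρ : Mat2} (ht : ρ.trace = 1) {x : ℝ} (hx : ρ 0 0 = (x : ℂ)) :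
    vnEntropy (diagPart ρ) = H2 x := by
  rw [Matrix.trace_fin_two, hx] at ht
  have h1 : ρ 1 1 = ((1 - x : ℝ) : ℂ) := by push_cast; linear_combination ht
  refine vnEntropy_eq_H2 ?_ ?_ ?_
  · ext i j
    fin_cases i <;> fin_cases j <;> simp [diagPart, hx, h1]
  · simp [diagPart, hx, h1]
  · simp [diagPart, hx, h1]

lemma vnEntropy_diagPart_mixture (μ ν : ℝ) (A B : U2) :
    vnEntropy (diagPart (mixture (conj A (diagState μ)) (conj B (diagState ν))))
      = H2 ((μ + ν + (1 - 2 * μ) * prob A + (1 - 2 * ν) * prob B) / 2) := by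
  refine vnEntropy_diagPart
    (trace_mixture (by rw [trace_conj, trace_diagState]) (by rw [trace_conj, trace_diagState])) ?_
  simp only [mixture, Matrix.add_apply, Matrix.smul_apply, smul_eq_mul, conj_diagState_zero_zero]
  push_cast
  ring

/-! ### The transition probability is uniformly distributed -/

lemma integrable_U2 {E : Type*} [NormedAddCommGroup E] {f : U2 → E} (hf : Continuous f) :
    Integrable f haarU2 :=
  hf.integrable_of_hasCompactSupport (HasCompactSupport.of_compactSpace f)

@[fun_prop]
lemma continuous_U2_entry (i j : Fin 2) : Continuous fun U : U2 => (U : Mat2) i j :=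
  (continuous_apply_apply i j).comp continuous_subtype_val

/-- The unitary `diag(1, ω)` for a phase `ω`. -/
noncomputable def phaseU2 (ω : ℂ) (h : ω * star ω = 1) : U2 :=
  ⟨Matrix.diagonal ![1, ω], Matrix.mem_unitaryGroup_iff.mpr (by
    ext i j
    fin_cases i <;> fin_cases j <;> simp_all [Matrix.star_eq_conjTranspose])⟩

/-- The rotation with first row proportional to `(1, t)`. -/
noncomputable def rotU2 (t : ℝ) : U2 :=
  ⟨(((√(1 + t ^ 2))⁻¹ : ℝ) : ℂ) • !![1, (t : ℂ); -(t : ℂ), 1],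
    Matrix.mem_unitaryGroup_iff.mpr (by
      have h : ((√(1 + t ^ 2))⁻¹ : ℝ) * (√(1 + t ^ 2))⁻¹ * (1 + t ^ 2) = 1 := by
        rw [← mul_inv, Real.mul_self_sqrt (by positivity), inv_mul_cancel₀ (by positivity)]
      have h' : ((((√(1 + t ^ 2))⁻¹ : ℝ) : ℂ)) * (((√(1 + t ^ 2))⁻¹ : ℝ) : ℂ) * (1 + (t : ℂ) ^ 2)
          = 1 := by exact_mod_cast h
      generalize (√(1 + t ^ 2))⁻¹ = c at h'
      ext i j
      fin_cases i <;> fin_cases j <;>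
        simp [Matrix.mul_apply, Fin.sum_univ_two, Matrix.star_eq_conjTranspose] <;>
        first | linear_combination h' | ring)⟩

lemma prob_rotU2_mul (t : ℝ) (U : U2) :
    prob (rotU2 t * U) = (1 + t ^ 2)⁻¹ * Complex.normSq ((U : Mat2) 0 0 + t * (U : Mat2) 1 0) := by
  have h : ((rotU2 t * U : U2) : Mat2) 0 0
      = (((√(1 + t ^ 2))⁻¹ : ℝ) : ℂ) * ((U : Mat2) 0 0 + t * (U : Mat2) 1 0) := by
    simp [rotU2, Matrix.mul_apply, Fin.sum_univ_two]
    ring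
  rw [prob, h, Complex.normSq_mul, Complex.normSq_ofReal, ← mul_inv,
    Real.mul_self_sqrt (by positivity)]

/-- Phase invariance: unbalanced moments of the first column of `U W` vanish. -/
lemma integral_monomial_eq_zero (W : U2) (a b : ℕ) {c d : ℕ} (hcd : c ≠ d) :
    ∫ U : U2, ((U * W : U2) : Mat2) 0 0 ^ a * star (((U * W : U2) : Mat2) 0 0) ^ b
      * (((U * W : U2) : Mat2) 1 0 ^ c * star (((U * W : U2) : Mat2) 1 0) ^ d) ∂haarU2 = 0 := by
  -- This angle makes `ω ^ c * star ω ^ d = exp(i(c - d)θ) = -1`, so translation by `diag(1, ω)`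
  -- negates the integrand and the integral equals its own negative.
  set θ : ℝ := Real.pi / ((c : ℝ) - d) with hθ
  have hne : (c : ℝ) - d ≠ 0 := sub_ne_zero.mpr (by exact_mod_cast hcd)
  set ω : ℂ := Complex.exp (θ * Complex.I) with hω
  have hstar : star ω = Complex.exp (-(θ * Complex.I)) := by
    rw [hω, Complex.star_def, ← Complex.exp_conj]
    simp
  have hunit : ω * star ω = 1 := by
    rw [hstar, hω, ← Complex.exp_add, add_neg_cancel, Complex.exp_zero]
  have hneg : ω ^ c * star ω ^ d = -1 := by
    rw [hstar, hω, ← Complex.exp_nat_mul, ← Complex.exp_nat_mul, ← Complex.exp_add,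
      ← Complex.exp_pi_mul_I]
    congr 1
    have : ((c : ℂ) - d) * θ = Real.pi := by
      rw [hθ]
      have : ((c : ℝ) - d) * (Real.pi / ((c : ℝ) - d)) = Real.pi := by field_simp
      exact_mod_cast this
    linear_combination Complex.I * this
  have h := integral_mul_left_eq_self (μ := haarU2) (fun U : U2 =>
    ((U * W : U2) : Mat2) 0 0 ^ a * star (((U * W : U2) : Mat2) 0 0) ^ b
      * (((U * W : U2) : Mat2) 1 0 ^ c * star (((U * W : U2) : Mat2) 1 0) ^ d)) (phaseU2 ω hunit)
  have h0 : ∀ U : U2, ((phaseU2 ω hunit * U * W : U2) : Mat2) 0 0 = ((U * W : U2) : Mat2) 0 0 := by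
    intro U
    rw [mul_assoc]
    simp [phaseU2]
  have h1 : ∀ U : U2, ((phaseU2 ω hunit * U * W : U2) : Mat2) 1 0
      = ω * ((U * W : U2) : Mat2) 1 0 := by
    intro U
    rw [mul_assoc]
    simp [phaseU2]
  have h2 : ∀ z w : ℂ, z * ((ω * w) ^ c * star (ω * w) ^ d) = - (z * (w ^ c * star w ^ d)) := by
    intro z w
    rw [star_mul', mul_pow, mul_pow]
    linear_combination (z * (w ^ c * star w ^ d)) * hneg
  simp only [h0, h1, h2] at h
  rw [integral_neg] at h
  exact self_eq_neg.mp h.symm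

/-- Left invariance under `rotU2 t`, which mixes the two entries of the first column. Carrying the
right factor `W` throughout means that left invariance of the measure suffices. -/
lemma integral_normSq_pow (W : U2) (t : ℝ) (k : ℕ) :
    ∫ U : U2, Complex.normSq (((U * W : U2) : Mat2) 0 0 + t * ((U * W : U2) : Mat2) 1 0) ^ k ∂haarU2
      = (1 + t ^ 2) ^ k * ∫ U : U2, prob (U * W) ^ k ∂haarU2 := by
  have h := integral_mul_left_eq_self (μ := haarU2) (fun U : U2 => prob (U * W) ^ k) (rotU2 t)
  simp only [mul_assoc, prob_rotU2_mul, mul_pow] at h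
  rw [integral_const_mul] at h
  rw [← h, ← mul_assoc, ← mul_pow, mul_inv_cancel₀ (by positivity), one_pow, one_mul]

/-- In the double binomial expansion of `(z + tw)^k` times its conjugate, phase invariance kills
every term with unequal powers of `w` and its conjugate. -/
lemma integral_normSq_pow_expand (W : U2) (t : ℝ) (k : ℕ) :
    ∫ U : U2, Complex.normSq (((U * W : U2) : Mat2) 0 0 + t * ((U * W : U2) : Mat2) 1 0) ^ k ∂haarU2
      = ∑ m ∈ Finset.range (k + 1), (k.choose m : ℝ) ^ 2 * (t ^ 2) ^ m
        * ∫ U : U2, prob (U * W) ^ (k - m)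
          * Complex.normSq (((U * W : U2) : Mat2) 1 0) ^ m ∂haarU2 := by
  have hpt : ∀ z w : ℂ, ((Complex.normSq (z + t * w) ^ k : ℝ) : ℂ)
      = ∑ c ∈ Finset.range (k + 1), ∑ d ∈ Finset.range (k + 1),
        ((k.choose c : ℂ) * k.choose d * t ^ (c + d)) *
          (z ^ (k - c) * star z ^ (k - d) * (w ^ c * star w ^ d)) := by
    intro z w
    have e : ∀ a b : ℂ, (a + t * b) ^ k = ∑ c ∈ Finset.range (k + 1),
        (k.choose c : ℂ) * t ^ c * (a ^ (k - c) * b ^ c) := by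
      intro a b
      rw [add_comm, add_pow]
      refine Finset.sum_congr rfl fun c _ => ?_
      rw [mul_pow]; ring
    rw [Complex.ofReal_pow, ← Complex.mul_conj, map_add, map_mul, Complex.conj_ofReal, mul_pow, e, e,
      Finset.sum_mul_sum]
    refine Finset.sum_congr rfl fun c _ => Finset.sum_congr rfl fun d _ => ?_
    simp only [Complex.star_def]
    ring
  have hint : ∀ c d : ℕ, Integrable (fun U : U2 => ((k.choose c : ℂ) * k.choose d * t ^ (c + d)) *
      (((U * W : U2) : Mat2) 0 0 ^ (k - c) * star (((U * W : U2) : Mat2) 0 0) ^ (k - d) *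
        (((U * W : U2) : Mat2) 1 0 ^ c * star (((U * W : U2) : Mat2) 1 0) ^ d))) haarU2 := by
    intro c d
    have hc : ∀ i : Fin 2, Continuous fun U : U2 => ((U * W : U2) : Mat2) i 0 := fun i =>
      (continuous_U2_entry i 0).comp (continuous_mul_const W)
    have h0 := hc 0
    have h1 := hc 1
    exact integrable_U2 (by fun_prop)
  apply Complex.ofReal_injective
  rw [← integral_complex_ofReal]
  simp only [hpt]
  rw [integral_finsetSum _ fun c _ => integrable_finsetSum _ fun d _ => hint c d]
  rw [Complex.ofReal_sum]
  refine Finset.sum_congr rfl fun c hc => ?_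
  rw [integral_finsetSum _ fun d _ => hint c d, Finset.sum_eq_single c]
  · rw [integral_const_mul, Complex.ofReal_mul, ← integral_complex_ofReal]
    congr 1
    · push_cast
      ring
    · congr 1
      funext U
      simp only [prob, Complex.ofReal_mul, Complex.ofReal_pow]
      rw [← Complex.mul_conj, ← Complex.mul_conj, mul_pow, mul_pow]
      rfl
  · intro d _ hd
    rw [integral_const_mul, integral_monomial_eq_zero W _ _ hd.symm, mul_zero]
  · exact fun h => absurd hc h

/-- These are the moments of the uniform law. Comparing the two evaluations of the rotated moment as
polynomials in `t²` shows that all terms `(k choose m) * M m` equal the `k`-th moment `f`; the `k +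
1` of them sum to `1`. -/
lemma integral_prob_pow (W : U2) (k : ℕ) :
    ∫ U : U2, prob (U * W) ^ k ∂haarU2 = 1 / (k + 1) := by
  set M : ℕ → ℝ := fun m => ∫ U : U2, prob (U * W) ^ (k - m)
          * Complex.normSq (((U * W : U2) : Mat2) 1 0) ^ m ∂haarU2 with hM
  set f : ℝ := ∫ U : U2, prob (U * W) ^ k ∂haarU2 with hf
  have hpoly : (∑ m ∈ Finset.range (k + 1),
        Polynomial.C ((k.choose m : ℝ) ^ 2 * M m) * Polynomial.X ^ m)
      = Polynomial.C f * (1 + Polynomial.X) ^ k := by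
    -- Taking `t = √x` gives equality at every `x ≥ 0`, hence of polynomials.
    refine Polynomial.eq_of_infinite_eval_eq _ _ ((Set.Ici_infinite (0 : ℝ)).mono ?_)
    intro x hx
    have h := (integral_normSq_pow_expand W (√x) k).symm.trans (integral_normSq_pow W (√x) k)
    rw [Real.sq_sqrt hx] at h
    simp only [Set.mem_ofPred_eq, Polynomial.eval_finsetSum, Polynomial.eval_mul,
      Polynomial.eval_C, Polynomial.eval_pow, Polynomial.eval_X, Polynomial.eval_add,
      Polynomial.eval_one]
    rw [mul_comm f, ← h]
    refine Finset.sum_congr rfl fun m _ => ?_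
    ring
  have hcoef : ∀ m ∈ Finset.range (k + 1), (k.choose m : ℝ) * M m = f := by
    intro m hm
    have h := congrArg (fun p => Polynomial.coeff p m) hpoly
    simp only [Polynomial.finsetSum_coeff, Polynomial.coeff_C_mul, Polynomial.coeff_X_pow,
      mul_ite, mul_one, mul_zero, Polynomial.coeff_one_add_X_pow] at h
    rw [Finset.sum_ite_eq, if_pos hm] at h
    have hpos : (k.choose m : ℝ) ≠ 0 := by
      exact_mod_cast (Nat.choose_pos (Nat.lt_succ_iff.mp (Finset.mem_range.mp hm))).ne'
    apply mul_left_cancel₀ hpos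
    linear_combination h
  -- The integrated binomial expansion of `(|z|² + |w|²)^k = 1` for the unit first column.
  have hsum : ∑ m ∈ Finset.range (k + 1), (k.choose m : ℝ) * M m = 1 := by
    have hq : Continuous fun U : U2 => Complex.normSq (((U * W : U2) : Mat2) 1 0) :=
      Complex.continuous_normSq.comp ((continuous_U2_entry 1 0).comp (continuous_mul_const W))
    simp only [hM, ← integral_const_mul]
    rw [← integral_finsetSum _ fun m _ => integrable_U2 (by fun_prop)]
    have : ∀ U : U2, ∑ m ∈ Finset.range (k + 1), (k.choose m : ℝ) * (prob (U * W) ^ (k - m)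
          * Complex.normSq (((U * W : U2) : Mat2) 1 0) ^ m) = 1 := by
      intro U
      have h := congrArg (· ^ k) (prob_add_normSq_col (U * W))
      simp only [one_pow] at h
      rw [← h, add_comm (prob _), add_pow]
      refine Finset.sum_congr rfl fun m _ => ?_
      ring
    simp only [this, integral_const, probReal_univ, one_smul]
  rw [Finset.sum_congr rfl hcoef, Finset.sum_const, Finset.card_range, nsmul_eq_mul] at hsum
  push_cast at hsum
  have : (k : ℝ) + 1 ≠ 0 := by positivity
  field_simp
  linarith

lemma integral_eval_prob (W : U2) (p : Polynomial ℝ) :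
    ∫ U : U2, p.eval (prob (U * W)) ∂haarU2 = ∫ x in (0 : ℝ)..1, p.eval x := by
  simp only [Polynomial.eval_eq_sum_range]
  rw [integral_finsetSum _ fun i _ => integrable_U2 (by fun_prop),
    intervalIntegral.integral_finsetSum fun i _ => (by
      apply Continuous.intervalIntegrable; fun_prop)]
  refine Finset.sum_congr rfl fun i _ => ?_
  rw [integral_const_mul, intervalIntegral.integral_const_mul, integral_prob_pow, integral_pow]
  simp

/-- For a Haar unitary `U` the transition probability `|(U W)₀₀|²` is uniform on `[0, 1]`. -/
theorem integral_comp_prob (W : U2) {g : ℝ → ℝ} (hg : Continuous g) :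
    ∫ U : U2, g (prob (U * W)) ∂haarU2 = ∫ x in (0 : ℝ)..1, g x := by
  refine eq_of_forall_dist_le fun ε hε => ?_
  -- Weierstrass approximation: both measures have mass one, so replacing `g` by `p` costs at most
  -- `ε / 2` on each side.
  obtain ⟨p, hp⟩ := exists_polynomial_near_of_continuousOn 0 1 g hg.continuousOn (ε / 2)
    (half_pos hε)
  have h1 : ‖∫ U : U2, (p.eval (prob (U * W)) - g (prob (U * W))) ∂haarU2‖ ≤ ε / 2 := by
    have := norm_integral_le_of_norm_le_const (μ := haarU2) (C := ε / 2)
      (f := fun U : U2 => p.eval (prob (U * W)) - g (prob (U * W)))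
      (ae_of_all _ fun U => (hp _ (prob_mem_Icc _)).le)
    simpa using this
  have h2 : ‖∫ x in (0 : ℝ)..1, (p.eval x - g x)‖ ≤ ε / 2 := by
    have := intervalIntegral.norm_integral_le_of_norm_le_const (a := (0 : ℝ)) (b := 1) (C := ε / 2)
      (f := fun x => p.eval x - g x) (fun x hx => by
        rw [Set.uIoc_of_le zero_le_one] at hx
        exact (hp x ⟨hx.1.le, hx.2⟩).le)
    simpa using this
  rw [integral_sub (integrable_U2 (by fun_prop)) (integrable_U2 (by fun_prop)),
    integral_eval_prob] at h1
  rw [intervalIntegral.integral_sub (by apply Continuous.intervalIntegrable; fun_prop)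
    (hg.intervalIntegrable _ _)] at h2
  rw [Real.norm_eq_abs, abs_le] at h1 h2
  rw [Real.dist_eq, abs_le]
  constructor <;> linarith [h1.1, h1.2, h2.1, h2.2]

/-! ### Antiderivatives -/

lemma hasDerivAt_F0 {x : ℝ} (hx : x ∈ Set.Ioo (0 : ℝ) 1) : HasDerivAt F0 (H2 x) x := by
  have h0 : x ≠ 0 := hx.1.ne'
  have h1 : 1 - x ≠ 0 := (sub_pos.mpr hx.2).ne'
  have hs : HasDerivAt (fun y : ℝ => 1 - y) (-1) x := by
    simpa using (hasDerivAt_id x).const_sub 1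
  have hl := hs.log h1
  have hl0 := Real.hasDerivAt_log h0
  have h := (((hs.pow 2).const_mul (1 / 4)).mul ((hl.const_mul 2).sub_const 1)).sub
    (((hasDerivAt_pow 2 x).const_mul (1 / 4)).mul ((hl0.const_mul 2).sub_const 1))
  refine h.congr_deriv ?_
  simp only [H2]
  field_simp
  simp
  ring

lemma hasDerivAt_F1 {x : ℝ} (hx : x ∈ Set.Ioo (0 : ℝ) 1) : HasDerivAt F1 (x * H2 x) x := by
  have h0 : x ≠ 0 := hx.1.ne'
  have h1 : 1 - x ≠ 0 := (sub_pos.mpr hx.2).ne'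
  have hs : HasDerivAt (fun y : ℝ => 1 - y) (-1) x := by
    simpa using (hasDerivAt_id x).const_sub 1
  have hl := hs.log h1
  have hl0 := Real.hasDerivAt_log h0
  have h := ((((hs.pow 2).const_mul (1 / 4)).mul ((hl.const_mul 2).sub_const 1)).sub
    (((hs.pow 3).const_mul (1 / 9)).mul ((hl.const_mul 3).sub_const 1))).sub
    (((hasDerivAt_pow 3 x).const_mul (1 / 9)).mul ((hl0.const_mul 3).sub_const 1))
  refine h.congr_deriv ?_
  simp only [H2]
  field_simp
  simp
  ring

@[fun_prop]
lemma continuous_F0 : Continuous F0 := by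
  -- Each logarithm is grouped as `y * log y`, which is continuous at `0`.
  have h : F0 = fun x => 1 / 2 * (1 - x) * ((1 - x) * Real.log (1 - x)) - 1 / 4 * (1 - x) ^ 2
      - 1 / 2 * x * (x * Real.log x) + 1 / 4 * x ^ 2 := by
    funext x
    simp only [F0]
    ring
  have hl := Real.continuous_mul_log
  have hl' : Continuous fun x : ℝ => (1 - x) * Real.log (1 - x) :=
    hl.comp (continuous_const.sub continuous_id)
  rw [h]
  fun_prop

@[fun_prop]
lemma continuous_F1 : Continuous F1 := by
  have h : F1 = fun x => 1 / 2 * (1 - x) * ((1 - x) * Real.log (1 - x)) - 1 / 4 * (1 - x) ^ 2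
      - 1 / 3 * (1 - x) ^ 2 * ((1 - x) * Real.log (1 - x)) + 1 / 9 * (1 - x) ^ 3
      - 1 / 3 * x ^ 2 * (x * Real.log x) + 1 / 9 * x ^ 3 := by
    funext x
    simp only [F1]
    ring
  have hl := Real.continuous_mul_log
  have hl' : Continuous fun x : ℝ => (1 - x) * Real.log (1 - x) :=
    hl.comp (continuous_const.sub continuous_id)
  rw [h]
  fun_prop

lemma F0_one_sub (x : ℝ) : F0 (1 - x) = -F0 x := by
  simp only [F0, sub_sub_cancel]
  ring

lemma integral_H2 {a b : ℝ} (ha : 0 ≤ a) (hab : a ≤ b) (hb : b ≤ 1) :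
    ∫ x in a..b, H2 x = F0 b - F0 a :=
  intervalIntegral.integral_eq_sub_of_hasDerivAt_of_le hab continuous_F0.continuousOn
    (fun _ hx => hasDerivAt_F0 ⟨ha.trans_lt hx.1, hx.2.trans_le hb⟩)
    (continuous_H2.intervalIntegrable _ _)

/-- Integration by parts: `x F₀ - F₁` has derivative `F₀ + x H₂ - x H₂`. -/
lemma integral_F0 {a b : ℝ} (ha : 0 ≤ a) (hab : a ≤ b) (hb : b ≤ 1) :
    ∫ x in a..b, F0 x = (b * F0 b - F1 b) - (a * F0 a - F1 a) := by
  refine intervalIntegral.integral_eq_sub_of_hasDerivAt_of_le (f := fun x => x * F0 x - F1 x) hab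
    (by fun_prop) (fun x hx => ?_) (continuous_F0.intervalIntegrable _ _)
  have hx' : x ∈ Set.Ioo (0 : ℝ) 1 := ⟨ha.trans_lt hx.1, hx.2.trans_le hb⟩
  refine (((hasDerivAt_id x).mul (hasDerivAt_F0 hx')).sub (hasDerivAt_F1 hx')).congr_deriv ?_
  simp

/-! ### The averages as parametric integrals -/

/-- The average entropy of the mixture, for a uniform transition probability. -/
noncomputable def avgMixEntropy (μ ν : ℝ) : ℝ := ∫ p in (0 : ℝ)..1, mixEntropy μ ν p

/-- The average entropy of the diagonal part of the mixture. -/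
noncomputable def avgDiagEntropy (μ ν : ℝ) : ℝ :=
  ∫ p in (0 : ℝ)..1, ∫ q in (0 : ℝ)..1, H2 ((μ + ν + (1 - 2 * μ) * p + (1 - 2 * ν) * q) / 2)

lemma continuous_mixEntropy_uncurry :
    Continuous fun x : (ℝ × ℝ) × ℝ => mixEntropy x.1.1 x.1.2 x.2 := by
  unfold mixEntropy mixRadius
  fun_prop

lemma continuous_mixEntropy (μ ν : ℝ) : Continuous (mixEntropy μ ν) := by
  unfold mixEntropy mixRadius
  fun_prop

/-- No domain restriction is needed: `√` is continuous with value `0` on negatives, and `H2` is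
continuous on all of `ℝ`. -/
lemma continuous_avgMixEntropy : Continuous fun x : ℝ × ℝ => avgMixEntropy x.1 x.2 :=
  intervalIntegral.continuous_parametric_intervalIntegral_of_continuous'
    continuous_mixEntropy_uncurry 0 1

lemma continuous_avgDiagEntropy : Continuous fun x : ℝ × ℝ => avgDiagEntropy x.1 x.2 := by
  refine intervalIntegral.continuous_parametric_intervalIntegral_of_continuous' ?_ 0 1
  refine intervalIntegral.continuous_parametric_intervalIntegral_of_continuous' (X := (ℝ × ℝ) × ℝ)
    (f := fun x q => H2 ((x.1.1 + x.1.2 + (1 - 2 * x.1.1) * x.2 + (1 - 2 * x.1.2) * q) / 2)) ?_ 0 1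
  unfold Function.uncurry
  fun_prop

lemma mixRadius_zero (μ ν : ℝ) : mixRadius μ ν 0 = |μ - ν| := by
  rw [mixRadius, mul_zero, add_zero, Real.sqrt_sq_eq_abs]

lemma mixRadius_one {μ ν : ℝ} (h : μ + ν ≤ 1) : mixRadius μ ν 1 = 1 - (μ + ν) := by
  rw [mixRadius, show (μ - ν) ^ 2 + (1 - 2 * μ) * (1 - 2 * ν) * 1 = (1 - (μ + ν)) ^ 2 by ring,
    Real.sqrt_sq (by linarith)]

theorem avgMixEntropy_eq {μ ν : ℝ} (hμ : μ ∈ Set.Ico (0 : ℝ) (1 / 2))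
    (hν : ν ∈ Set.Ico (0 : ℝ) (1 / 2)) :
    avgMixEntropy μ ν = Phi μ ν / ((1 / 2 - μ) * (1 / 2 - ν)) := by
  obtain ⟨hμ0, hμ1⟩ := hμ
  obtain ⟨hν0, hν1⟩ := hν
  have ha : 0 < 1 / 2 - μ := by linarith
  have hb : 0 < 1 / 2 - ν := by linarith
  have hab : 0 < (1 / 2 - μ) * (1 / 2 - ν) := mul_pos ha hb
  have hr : Continuous (mixRadius μ ν) := by unfold mixRadius; fun_prop
  have h := intervalIntegral.integral_eq_sub_of_hasDerivAt_of_le (zero_le_one' ℝ)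
    -- With `x = (1 - r)/2`, symmetry of `H2` makes the derivative `x'(2x - 1) H₂(x) = (r r'/2)
    -- H₂(x)`, and `r r'` is constant because `r²` is affine in `p`. The endpoints `p = 0, 1` give
    -- `x = T₁, T₀`.
    (f := fun p => F1 ((1 - mixRadius μ ν p) / 2) + F1 (1 - (1 - mixRadius μ ν p) / 2))
    (f' := fun p => (1 / 2 - μ) * (1 / 2 - ν) * mixEntropy μ ν p)
    (by fun_prop) (fun p hp => ?_)
    (((continuous_mixEntropy μ ν).const_mul _).intervalIntegrable _ _)
  · rw [intervalIntegral.integral_const_mul, mixRadius_zero, mixRadius_one (by linarith)] at h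
    rw [avgMixEntropy, eq_div_iff hab.ne', mul_comm, h]
    simp only [Phi, T0, T1, sub_sub_cancel]
    ring
  · have hpos : 0 < (μ - ν) ^ 2 + (1 - 2 * μ) * (1 - 2 * ν) * p := by
      have := mul_pos hab hp.1
      nlinarith [sq_nonneg (μ - ν)]
    have hr0 : 0 < mixRadius μ ν p := Real.sqrt_pos.mpr hpos
    have hr1 : mixRadius μ ν p < 1 := by
      rw [mixRadius, Real.sqrt_lt' one_pos]
      have := mul_pos hab (sub_pos.mpr hp.2)
      nlinarith [mul_nonneg hμ0 hν0]
    have hd : HasDerivAt (mixRadius μ ν) ((1 - 2 * μ) * (1 - 2 * ν) / (2 * mixRadius μ ν p)) p := by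
      have := (((hasDerivAt_id p).const_mul ((1 - 2 * μ) * (1 - 2 * ν))).const_add
        ((μ - ν) ^ 2)).sqrt hpos.ne'
      rw [mul_one] at this
      exact this
    have hx := (hd.const_sub 1).div_const 2
    have hA := (hasDerivAt_F1 (x := (1 - mixRadius μ ν p) / 2)
      ⟨by linarith, by linarith⟩).comp p hx
    have hB := (hasDerivAt_F1 (x := 1 - (1 - mixRadius μ ν p) / 2)
      ⟨by linarith, by linarith⟩).comp p (hx.const_sub 1)
    refine (hA.add hB).congr_deriv ?_
    rw [H2_one_sub, mixEntropy]
    field_simp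
    ring

theorem avgDiagEntropy_eq {μ ν : ℝ} (hμ : μ ∈ Set.Ico (0 : ℝ) (1 / 2))
    (hν : ν ∈ Set.Ico (0 : ℝ) (1 / 2)) :
    avgDiagEntropy μ ν
      = ((2 * T0 μ ν - 1) * F0 (T0 μ ν) - (2 * T1 μ ν - 1) * F0 (T1 μ ν) - Phi μ ν)
        / ((1 / 2 - μ) * (1 / 2 - ν)) := by
  obtain ⟨hμ0, hμ1⟩ := hμ
  obtain ⟨hν0, hν1⟩ := hν
  have ha : 0 < 1 / 2 - μ := by linarith
  have hb : 0 < 1 / 2 - ν := by linarith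
  have inner : ∀ p ∈ Set.uIcc (0 : ℝ) 1,
      ∫ q in (0 : ℝ)..1, H2 ((μ + ν + (1 - 2 * μ) * p + (1 - 2 * ν) * q) / 2)
        = (1 / 2 - ν)⁻¹ * (F0 ((1 / 2 - μ) * p + (1 + μ - ν) / 2)
          - F0 ((1 / 2 - μ) * p + (μ + ν) / 2)) := by
    intro p hp
    rw [Set.uIcc_of_le zero_le_one] at hp
    have hap : 0 ≤ (1 / 2 - μ) * p := mul_nonneg ha.le hp.1
    have hap' : (1 / 2 - μ) * p ≤ 1 / 2 - μ := mul_le_of_le_one_right ha.le hp.2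
    have e : ∀ q : ℝ, (μ + ν + (1 - 2 * μ) * p + (1 - 2 * ν) * q) / 2
        = (1 / 2 - ν) * q + ((1 / 2 - μ) * p + (μ + ν) / 2) := fun q => by ring
    simp only [e]
    rw [intervalIntegral.integral_comp_mul_add _ hb.ne', integral_H2 (by linarith) (by linarith)
      (by linarith), smul_eq_mul]
    congr 3 <;> ring_nf
  rw [avgDiagEntropy, intervalIntegral.integral_congr inner, intervalIntegral.integral_const_mul,
    intervalIntegral.integral_sub (by apply Continuous.intervalIntegrable; fun_prop)
      (by apply Continuous.intervalIntegrable; fun_prop),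
    intervalIntegral.integral_comp_mul_add _ ha.ne',
    intervalIntegral.integral_comp_mul_add _ ha.ne', integral_F0 (by linarith) (by linarith)
      (by linarith), integral_F0 (by linarith) (by linarith) (by linarith), smul_eq_mul, smul_eq_mul]
  -- The four limits of integration form two pairs `{T, 1 - T}`, for `T₀` and `T₁`.
  have e1 : (1 / 2 - μ) * 1 + (1 + μ - ν) / 2 = 1 - (μ + ν) / 2 := by ring
  have e2 : (1 / 2 - μ) * 0 + (1 + μ - ν) / 2 = (1 + μ - ν) / 2 := by ring
  have e3 : (1 / 2 - μ) * 1 + (μ + ν) / 2 = 1 - (1 + μ - ν) / 2 := by ring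
  have e4 : (1 / 2 - μ) * 0 + (μ + ν) / 2 = (μ + ν) / 2 := by ring
  rw [e1, e2, e3, e4]
  -- The sign of `μ - ν` is immaterial: `(2T - 1) F₀(T)` and `F₁(T) + F₁(1 - T)` are invariant under
  -- `T ↦ 1 - T`.
  have hT1 : T1 μ ν = (1 + μ - ν) / 2 ∨ T1 μ ν = 1 - (1 + μ - ν) / 2 := by
    rw [T1]
    rcases abs_cases (μ - ν) with h | h
    · right; rw [h.1]; ring
    · left; rw [h.1]; ring
  rcases hT1 with h | h <;> simp only [Phi, h, T0, F0_one_sub, sub_sub_cancel] <;> field_simp <;> ring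

/-! ### Haar averages -/

/-- Left invariance absorbs `A⁻¹`, so the inner average over `V` does not depend on `U` when this is
used with `U * A` for `A`. -/
lemma integral_mixEntropy_prob (μ ν : ℝ) (A B : U2) :
    ∫ V : U2, mixEntropy μ ν (prob (A⁻¹ * (V * B))) ∂haarU2 = avgMixEntropy μ ν := by
  have h := integral_mul_left_eq_self (μ := haarU2)
    (fun V : U2 => mixEntropy μ ν (prob (V * B))) A⁻¹
  simp only [mul_assoc] at h
  rw [h, integral_comp_prob B (continuous_mixEntropy μ ν), avgMixEntropy]

section

variable {μ ν : ℝ} (A B : U2)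

lemma QJSD_conj_diagState (hμ : μ ≤ 1 / 2) (hν : ν ≤ 1 / 2) (U V : U2) :
    QJSD (conj U (conj A (diagState μ))) (conj V (conj B (diagState ν)))
      = mixEntropy μ ν (prob ((U * A)⁻¹ * (V * B))) - 1 / 2 * H2 μ - 1 / 2 * H2 ν := by
  rw [QJSD_eq_vnEntropy, conj_conj, conj_conj, vnEntropy_mixture hμ hν, vnEntropy_conj_diagState,
    vnEntropy_conj_diagState]

lemma coherence_conj_diagState (hμ : μ ≤ 1 / 2) (hν : ν ≤ 1 / 2) (U V : U2) :
    coherence (mixture (conj U (conj A (diagState μ))) (conj V (conj B (diagState ν))))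
      = H2 ((μ + ν + (1 - 2 * μ) * prob (U * A) + (1 - 2 * ν) * prob (V * B)) / 2)
        - mixEntropy μ ν (prob ((U * A)⁻¹ * (V * B))) := by
  rw [coherence, conj_conj, conj_conj, vnEntropy_mixture hμ hν, vnEntropy_diagPart_mixture]

theorem avgQJSD_conj_diagState (hμ : μ ≤ 1 / 2) (hν : ν ≤ 1 / 2) :
    avgQJSD (conj A (diagState μ)) (conj B (diagState ν))
      = avgMixEntropy μ ν - 1 / 2 * H2 μ - 1 / 2 * H2 ν := by
  have hc := continuous_mixEntropy μ ν
  have hi : ∀ U : U2, ∫ V : U2, QJSD (conj U (conj A (diagState μ)))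
      (conj V (conj B (diagState ν))) ∂haarU2
      = avgMixEntropy μ ν - 1 / 2 * H2 μ - 1 / 2 * H2 ν := by
    intro U
    simp only [QJSD_conj_diagState A B hμ hν]
    rw [integral_sub (integrable_U2 (by fun_prop)) (integrable_const _),
      integral_sub (integrable_U2 (by fun_prop)) (integrable_const _), integral_mixEntropy_prob]
    simp
  simp [avgQJSD, hi]

theorem avgCoherence_conj_diagState (hμ : μ ≤ 1 / 2) (hν : ν ≤ 1 / 2) :
    avgCoherence (conj A (diagState μ)) (conj B (diagState ν))
      = avgDiagEntropy μ ν - avgMixEntropy μ ν := by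
  have hc := continuous_mixEntropy μ ν
  have hi : ∀ U : U2, ∫ V : U2, coherence (mixture (conj U (conj A (diagState μ)))
      (conj V (conj B (diagState ν)))) ∂haarU2
      = (∫ q in (0 : ℝ)..1, H2 ((μ + ν + (1 - 2 * μ) * prob (U * A) + (1 - 2 * ν) * q) / 2))
        - avgMixEntropy μ ν := by
    intro U
    simp only [coherence_conj_diagState A B hμ hν]
    rw [integral_sub (integrable_U2 (by fun_prop)) (integrable_U2 (by fun_prop)),
      integral_mixEntropy_prob, integral_comp_prob B
        (g := fun q => H2 ((μ + ν + (1 - 2 * μ) * prob (U * A) + (1 - 2 * ν) * q) / 2))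
        (by fun_prop)]
  have hg : Continuous fun p : ℝ =>
      ∫ q in (0 : ℝ)..1, H2 ((μ + ν + (1 - 2 * μ) * p + (1 - 2 * ν) * q) / 2) :=
    intervalIntegral.continuous_parametric_intervalIntegral_of_continuous'
      (by unfold Function.uncurry; fun_prop) 0 1
  have hg' : Continuous fun U : U2 =>
      ∫ q in (0 : ℝ)..1, H2 ((μ + ν + (1 - 2 * μ) * prob (U * A) + (1 - 2 * ν) * q) / 2) :=
    hg.comp (by fun_prop : Continuous fun U : U2 => prob (U * A))
  simp only [avgCoherence, hi]
  rw [integral_sub (integrable_U2 hg') (integrable_const _),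
    integral_comp_prob A hg, avgDiagEntropy]
  simp

lemma integrable_QJSD (hμ : μ ≤ 1 / 2) (hν : ν ≤ 1 / 2) :
    Integrable (fun p : U2 × U2 =>
      QJSD (conj p.1 (conj A (diagState μ))) (conj p.2 (conj B (diagState ν))))
      (haarU2.prod haarU2) := by
  have hc := continuous_mixEntropy μ ν
  simp only [QJSD_conj_diagState A B hμ hν]
  exact Continuous.integrable_of_hasCompactSupport (by fun_prop)
    (HasCompactSupport.of_compactSpace _)

lemma integrable_coherence (hμ : μ ≤ 1 / 2) (hν : ν ≤ 1 / 2) :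
    Integrable (fun p : U2 × U2 => coherence
      (mixture (conj p.1 (conj A (diagState μ))) (conj p.2 (conj B (diagState ν)))))
      (haarU2.prod haarU2) := by
  have hc := continuous_mixEntropy μ ν
  simp only [coherence_conj_diagState A B hμ hν]
  exact Continuous.integrable_of_hasCompactSupport (by fun_prop)
    (HasCompactSupport.of_compactSpace _)

end

/-! ### Closed forms -/

lemma phiFormula_eq {μ ν : ℝ} (hμ : μ ∈ Set.Ico (0 : ℝ) (1 / 2))
    (hν : ν ∈ Set.Ico (0 : ℝ) (1 / 2)) :
    phiFormula μ ν = avgMixEntropy μ ν - 1 / 2 * H2 μ - 1 / 2 * H2 ν := by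
  rw [phiFormula, avgMixEntropy_eq hμ hν]

lemma psiFormula_eq {μ ν : ℝ} (hμ : μ ∈ Set.Ico (0 : ℝ) (1 / 2))
    (hν : ν ∈ Set.Ico (0 : ℝ) (1 / 2)) :
    psiFormula μ ν = avgDiagEntropy μ ν - avgMixEntropy μ ν := by
  rw [psiFormula, avgMixEntropy_eq hμ hν, avgDiagEntropy_eq hμ hν, ← sub_div]
  ring

lemma tendsto_phiFormula (μ ν : ℝ) :
    Tendsto (fun q : ℝ × ℝ => phiFormula q.1 q.2)
      (𝓝[Set.Ico (0 : ℝ) (1 / 2) ×ˢ Set.Ico (0 : ℝ) (1 / 2)] (μ, ν))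
      (𝓝 (avgMixEntropy μ ν - 1 / 2 * H2 μ - 1 / 2 * H2 ν)) := by
  have hc : Continuous fun q : ℝ × ℝ =>
      avgMixEntropy q.1 q.2 - 1 / 2 * H2 q.1 - 1 / 2 * H2 q.2 := by
    have := continuous_avgMixEntropy
    fun_prop
  exact tendsto_nhdsWithin_congr (fun q hq => (phiFormula_eq hq.1 hq.2).symm)
    ((hc.tendsto (μ, ν)).mono_left nhdsWithin_le_nhds)

lemma tendsto_psiFormula (μ ν : ℝ) :
    Tendsto (fun q : ℝ × ℝ => psiFormula q.1 q.2)
      (𝓝[Set.Ico (0 : ℝ) (1 / 2) ×ˢ Set.Ico (0 : ℝ) (1 / 2)] (μ, ν))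
      (𝓝 (avgDiagEntropy μ ν - avgMixEntropy μ ν)) :=
  tendsto_nhdsWithin_congr (fun _ hq => (psiFormula_eq hq.1 hq.2).symm)
    (((continuous_avgDiagEntropy.sub continuous_avgMixEntropy).tendsto (μ, ν)).mono_left
      nhdsWithin_le_nhds)

end QubitOrbits

theorem mainTheorem9 :
    -- `F₀` and `F₁` are antiderivatives of `H₂(x)` and `x H₂(x)`
    (∀ x ∈ Set.Ioo (0 : ℝ) 1,
      HasDerivAt QubitOrbits.F0 (QubitOrbits.H2 x) x ∧
      HasDerivAt QubitOrbits.F1 (x * QubitOrbits.H2 x) x) ∧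
    -- both averages exist, and depend only on the orbits, for all spectra
    (∀ μ ∈ Set.Icc (0 : ℝ) (1 / 2), ∀ ν ∈ Set.Icc (0 : ℝ) (1 / 2),
      ∀ ρ₁ ∈ QubitOrbits.orbit μ, ∀ ρ₂ ∈ QubitOrbits.orbit ν,
      Integrable (fun p : QubitOrbits.U2 × QubitOrbits.U2 =>
          QubitOrbits.QJSD (QubitOrbits.conj p.1 ρ₁) (QubitOrbits.conj p.2 ρ₂))
        (QubitOrbits.haarU2.prod QubitOrbits.haarU2) ∧
      Integrable (fun p : QubitOrbits.U2 × QubitOrbits.U2 =>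
          QubitOrbits.coherence
            (QubitOrbits.mixture (QubitOrbits.conj p.1 ρ₁) (QubitOrbits.conj p.2 ρ₂)))
        (QubitOrbits.haarU2.prod QubitOrbits.haarU2) ∧
      -- the closed forms away from the maximally mixed spectrum
      (μ < 1 / 2 → ν < 1 / 2 →
        QubitOrbits.avgQJSD ρ₁ ρ₂ = QubitOrbits.phiFormula μ ν ∧
        QubitOrbits.avgCoherence ρ₁ ρ₂ = QubitOrbits.psiFormula μ ν) ∧
      -- on the whole square, the averages are the limits of the closed forms
      Tendsto (fun q : ℝ × ℝ => QubitOrbits.phiFormula q.1 q.2)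
        (𝓝[Set.Ico (0 : ℝ) (1 / 2) ×ˢ Set.Ico (0 : ℝ) (1 / 2)] (μ, ν))
        (𝓝 (QubitOrbits.avgQJSD ρ₁ ρ₂)) ∧
      Tendsto (fun q : ℝ × ℝ => QubitOrbits.psiFormula q.1 q.2)
        (𝓝[Set.Ico (0 : ℝ) (1 / 2) ×ˢ Set.Ico (0 : ℝ) (1 / 2)] (μ, ν))
        (𝓝 (QubitOrbits.avgCoherence ρ₁ ρ₂))) := by
  refine ⟨fun x hx => ⟨QubitOrbits.hasDerivAt_F0 hx, QubitOrbits.hasDerivAt_F1 hx⟩, ?_⟩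
  rintro μ ⟨hμ0, hμ⟩ ν ⟨hν0, hν⟩ _ ⟨A, rfl⟩ _ ⟨B, rfl⟩
  rw [QubitOrbits.avgQJSD_conj_diagState A B hμ hν,
    QubitOrbits.avgCoherence_conj_diagState A B hμ hν]
  exact ⟨QubitOrbits.integrable_QJSD A B hμ hν, QubitOrbits.integrable_coherence A B hμ hν,
    fun hμ' hν' => ⟨(QubitOrbits.phiFormula_eq ⟨hμ0, hμ'⟩ ⟨hν0, hν'⟩).symm,
      (QubitOrbits.psiFormula_eq ⟨hμ0, hμ'⟩ ⟨hν0, hν'⟩).symm⟩,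
    QubitOrbits.tendsto_phiFormula μ ν, QubitOrbits.tendsto_psiFormula μ ν⟩
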